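/- Let $G$ be a finite simple graph embedded in a closed connected surface $\Sigma$ (for example, by a 2-cell triangulation embedding of $G$ in a surface other than the sphere). Call a closed walk of $G$, and in particular a cycle, noncontractible if the closed curve that it traces is not null-homotopic in $\Sigma$. Lengths are numbers of edges. The width $w$ of the embedding is the length of a shortest noncontractible cycle of $G$. For a cycle $C$ of $G$, let $\mathrm{ncdist}(C)$ be the least length of a path (or cycle) $P$ of $G$ that begins at a vertex $x$ of $C$ and ends at a vertex $y$ of $C$ such that - if $x \neq y$, then $P$ is a path, and $P$ forms a noncontractible closed walk with each of the two arcs of $C$ between $x$ and $y$ (these closed walks are cycles when $P$ meets $C$ only in $x$ and $y$; the interior of $P$ is allowed to meet $C$); - if $x = y$, then $P$ is a noncontractible cycle through $x$. If there is no such $P$, put $\mathrm{ncdist}(C) = \infty$. If $C$ is a shortest noncontractible cycle of $G$, then $\mathrm{ncdist}(C) \geq w/2$. -/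

import Mathlib

open scoped ENNReal

/-- An embedding of a simple graph `G` in a topological space `S`: the vertices are distinct points
of `S`, every edge is a simple arc of `S` joining its two ends (the two orientations of an edge are
traversals of the same arc in opposite directions), and an interior point of an arc is neither a
vertex nor a point of another arc. -/
structure GraphEmbedding {V : Type*} (G : SimpleGraph V) (S : Type*) [TopologicalSpace S] where
  /-- the point of `S` that represents a vertex -/
  vertex : V → S
  /-- the arc of `S` that represents an edge, traversed from `u` to `v` -/
  edge : ∀ {u v : V}, G.Adj u v → Path (vertex u) (vertex v)
  vertex_injective : Function.Injective vertex
  edge_injective : ∀ {u v : V} (h : G.Adj u v), Function.Injective (edge h)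
  edge_symm : ∀ {u v : V} (h : G.Adj u v), edge h.symm = (edge h).symm
  edge_ne_vertex : ∀ {u v : V} (h : G.Adj u v) (t : unitInterval), t ≠ 0 → t ≠ 1 →
    ∀ w : V, edge h t ≠ vertex w
  edge_disjoint : ∀ {u v u' v' : V} (h : G.Adj u v) (h' : G.Adj u' v'), s(u, v) ≠ s(u', v') →
    ∀ t t' : unitInterval, t ≠ 0 → t ≠ 1 → edge h t ≠ edge h' t'

namespace GraphEmbedding

variable {V : Type*} {G : SimpleGraph V} {S : Type*} [TopologicalSpace S]

/-- The curve in `S` that is traced by a walk of the embedded graph. -/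
noncomputable def curve (E : GraphEmbedding G S) :
    ∀ {u v : V}, G.Walk u v → Path (E.vertex u) (E.vertex v)
  | _, _, .nil => Path.refl _
  | _, _, .cons h p => (E.edge h).trans (E.curve p)

/-- A closed walk (in particular, a cycle) is noncontractible if the closed curve that it traces is
not null-homotopic in `S`. -/
def Noncontractible (E : GraphEmbedding G S) {v : V} (c : G.Walk v v) : Prop :=
  ¬ (E.curve c).Homotopic (Path.refl (E.vertex v))

/-- The lengths of the noncontractible cycles. -/
def noncontractibleCycleLengths (E : GraphEmbedding G S) : Set ℕ :=
  {n | ∃ (v : V) (c : G.Walk v v), c.IsCycle ∧ E.Noncontractible c ∧ c.length = n}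

/-- The width of the embedding: the length of a shortest noncontractible cycle
(`⊤` if there is no noncontractible cycle). -/
noncomputable def width (E : GraphEmbedding G S) : ℕ∞ :=
  ⨅ n ∈ E.noncontractibleCycleLengths, (n : ℕ∞)

/-- `C` is a shortest noncontractible cycle. -/
def IsShortestNoncontractibleCycle (E : GraphEmbedding G S) {v : V} (C : G.Walk v v) : Prop :=
  C.IsCycle ∧ E.Noncontractible C ∧
    ∀ (u : V) (D : G.Walk u u), D.IsCycle → E.Noncontractible D → C.length ≤ D.length

open Classical in
/-- `A` and `B` are the two arcs into which `x` and `y` divide the cycle `C`: started at `x`,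
the cycle runs along `A` from `x` to `y` and then along `B` from `y` back to `x`. -/
def Arcs {v x y : V} (C : G.Walk v v) (A : G.Walk x y) (B : G.Walk y x) : Prop :=
  ∃ hx : x ∈ C.support, C.rotate x hx = A.append B

/-- The lengths of the paths `P` that count for `ncdist`: either `P` is a noncontractible cycle
through a vertex `x` of `C`, or `P` is a path between distinct vertices `x`, `y` of `C` which forms
a noncontractible closed walk with each of the two arcs of `C` between `x` and `y`. -/
def ncLengths (E : GraphEmbedding G S) {v : V} (C : G.Walk v v) : Set ℕ :=
  {n | (∃ x ∈ C.support, ∃ P : G.Walk x x,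
          P.IsCycle ∧ E.Noncontractible P ∧ P.length = n) ∨
       (∃ (x y : V) (A : G.Walk x y) (B : G.Walk y x) (P : G.Walk x y),
          x ≠ y ∧ Arcs C A B ∧ P.IsPath ∧
          E.Noncontractible (P.append B) ∧ E.Noncontractible (P.append A.reverse) ∧
          P.length = n)}

/-- The length of a shortest path that counts for `ncdist` (`⊤` if there is none). -/
noncomputable def ncdist (E : GraphEmbedding G S) {v : V} (C : G.Walk v v) : ℕ∞ :=
  ⨅ n ∈ E.ncLengths C, (n : ℕ∞)

end GraphEmbedding

namespace SimpleGraph.Walk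

variable {V : Type*} {G : SimpleGraph V}

/-! A noncontractible closed walk contains a noncontractible cycle that is no longer than itself:
otherwise each loop erased by `Walk.bypass` would be null-homotopic, and so would the walk. Hence
`C` is shortest among noncontractible closed walks too. If `P` counts for `ncdist` with arcs `A` and
`B`, then `P` with `A` and `P` with `B` both have length at least `|C|`; adding up, `2|P| + |C| ≥
2|C|`. -/

theorem IsPath.eq_cons_nil_of_mem_edges {u w : V} {p : G.Walk w u} (hp : p.IsPath)
    (h : G.Adj w u) (he : s(u, w) ∈ p.edges) : p = .cons h .nil := by
  cases p with
  | nil => simp at he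
  | @cons _ x _ h' q =>
    rw [cons_isPath_iff] at hp
    rw [edges_cons, List.mem_cons] at he
    rcases he with he | he
    · have hx : x = u := by
        rw [Sym2.eq_swap, Sym2.congr_right] at he
        exact he.symm
      subst hx
      rw [eq_nil_iff_nil.mpr (isPath_iff_nil.mp hp.1)]
    · exact absurd (q.snd_mem_support_of_mem_edges he) hp.2

end SimpleGraph.Walk

namespace GraphEmbedding

open SimpleGraph

variable {V : Type*} {G : SimpleGraph V} {S : Type*} [TopologicalSpace S]

theorem curve_append (E : GraphEmbedding G S) {u v w : V} (p : G.Walk u v) (q : G.Walk v w) :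
    (E.curve (p.append q)).Homotopic ((E.curve p).trans (E.curve q)) := by
  induction p with
  | nil => exact ⟨(Path.Homotopy.reflTrans (E.curve q)).symm⟩
  | cons h p ih =>
    exact (Path.Homotopic.hcomp (.refl (E.edge h)) (ih q)).trans
      ⟨(Path.Homotopy.transAssoc _ _ _).symm⟩

/-- A closed walk whose tail is a path is a cycle, or a single edge traversed back and forth. -/
theorem curve_cons_homotopic_refl (E : GraphEmbedding G S) {n : ℕ}
    (hE : ∀ (x : V) (D : G.Walk x x), D.IsCycle → D.length ≤ n →
      (E.curve D).Homotopic (Path.refl _))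
    {u w : V} (h : G.Adj u w) {p : G.Walk w u} (hp : p.IsPath) (hn : p.length + 1 ≤ n) :
    (E.curve (.cons h p)).Homotopic (Path.refl _) := by
  by_cases he : s(u, w) ∈ p.edges
  · rw [hp.eq_cons_nil_of_mem_edges h.symm he]
    change ((E.edge h).trans ((E.edge h.symm).trans (Path.refl _))).Homotopic _
    rw [E.edge_symm h]
    exact (Path.Homotopic.hcomp (.refl (E.edge h)) ⟨Path.Homotopy.transRefl _⟩).trans
      ⟨(Path.Homotopy.reflTransSymm _).symm⟩
  · exact hE u _ ((Walk.cons_isCycle_iff p h).mpr ⟨hp, he⟩) (by simpa using hn)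

/-- Each erased loop is an edge followed by a path, so it is null-homotopic. The bound `n` restricts
the hypothesis to short cycles, which later yields the length bound in `exists_isCycle`. -/
theorem curve_homotopic_curve_bypass [DecidableEq V] (E : GraphEmbedding G S) {n : ℕ}
    (hE : ∀ (x : V) (D : G.Walk x x), D.IsCycle → D.length ≤ n →
      (E.curve D).Homotopic (Path.refl _))
    {u v : V} (p : G.Walk u v) (hn : p.length ≤ n) :
    (E.curve p).Homotopic (E.curve p.bypass) := by
  induction p with
  | nil => exact .refl _
  | @cons u w v h p ih =>
    rw [Walk.length_cons] at hn
    have hcons : (E.curve (.cons h p)).Homotopic (E.curve (.cons h p.bypass)) :=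
      Path.Homotopic.hcomp (.refl (E.edge h)) (ih (by omega))
    by_cases hs : u ∈ p.bypass.support
    · simp only [Walk.bypass, hs, dif_pos]
      refine hcons.trans ?_
      have hlen : (p.bypass.takeUntil u hs).length + 1 ≤ n := by
        have := p.bypass.length_takeUntil_le_length hs
        have := p.length_bypass_le_length
        omega
      have hloop := E.curve_cons_homotopic_refl hE h (p.bypass_isPath.takeUntil hs) hlen
      -- Cut at the return to `u`: a null-homotopic loop, then the part that `bypass` keeps.
      have hsplit : Walk.cons h p.bypass =
          (Walk.cons h (p.bypass.takeUntil u hs)).append (p.bypass.dropUntil u hs) := by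
        rw [Walk.cons_append, Walk.take_spec]
      rw [hsplit]
      exact (E.curve_append _ _).trans
        ((Path.Homotopic.hcomp hloop (.refl _)).trans ⟨Path.Homotopy.reflTrans _⟩)
    · simpa only [Walk.bypass, hs, dif_neg, not_false_eq_true] using hcons

theorem Noncontractible.exists_isCycle {E : GraphEmbedding G S} {v : V} {c : G.Walk v v}
    (hc : E.Noncontractible c) :
    ∃ (x : V) (D : G.Walk x x), D.IsCycle ∧ E.Noncontractible D ∧ D.length ≤ c.length := by
  classical
  by_contra! hno
  refine hc ?_
  have h := E.curve_homotopic_curve_bypass (n := c.length)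
    (fun x D hD hl => by_contra fun hD' => absurd (hno x D hD hD') (by omega)) c le_rfl
  -- A closed path is trivial, so `c` would be contractible.
  rwa [Walk.eq_nil_iff_nil.mpr (Walk.isPath_iff_nil.mp c.bypass_isPath)] at h

theorem Arcs.length_add_length {v x y : V} {C : G.Walk v v} {A : G.Walk x y} {B : G.Walk y x}
    (h : Arcs C A B) : A.length + B.length = C.length := by
  classical
  obtain ⟨hx, h⟩ := h
  rw [← Walk.length_append, ← h, Walk.length_rotate]

theorem IsShortestNoncontractibleCycle.length_le {E : GraphEmbedding G S} {v : V}
    {C : G.Walk v v} (hC : E.IsShortestNoncontractibleCycle C) {x : V} {c : G.Walk x x}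
    (hc : E.Noncontractible c) : C.length ≤ c.length := by
  obtain ⟨u, D, hD, hD', hl⟩ := hc.exists_isCycle
  exact (hC.2.2 u D hD hD').trans hl

theorem IsShortestNoncontractibleCycle.length_le_two_mul {E : GraphEmbedding G S} {v : V}
    {C : G.Walk v v} (hC : E.IsShortestNoncontractibleCycle C) {n : ℕ}
    (hn : n ∈ E.ncLengths C) : C.length ≤ 2 * n := by
  rcases hn with ⟨x, -, P, -, hP, rfl⟩ | ⟨x, y, A, B, P, -, hAB, -, hB, hA, rfl⟩
  · have := hC.length_le hP
    omega
  · have h₁ := hC.length_le hB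
    have h₂ := hC.length_le hA
    have h₃ := hAB.length_add_length
    rw [Walk.length_append] at h₁ h₂
    rw [Walk.length_reverse] at h₂
    omega

theorem IsShortestNoncontractibleCycle.width_le {E : GraphEmbedding G S} {v : V}
    {C : G.Walk v v} (hC : E.IsShortestNoncontractibleCycle C) : E.width ≤ C.length :=
  iInf₂_le C.length ⟨v, C, hC.1, hC.2.1, rfl⟩

end GraphEmbedding

theorem proposition1 {V : Type*} [Finite V] (G : SimpleGraph V)
    {S : Type*} [TopologicalSpace S] [T2Space S] [CompactSpace S] [ConnectedSpace S]
    [ChartedSpace (EuclideanSpace ℝ (Fin 2)) S]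
    (E : GraphEmbedding G S) {v : V} (C : G.Walk v v)
    (hC : E.IsShortestNoncontractibleCycle C) :
    (E.width : ℝ≥0∞) / 2 ≤ (E.ncdist C : ℝ≥0∞) := by
  -- Half the length is rounded up so that the bound passes to the infimum in `ℕ∞`; doubling it back
  -- still gives at least `C.length`.
  have hdist : (((C.length + 1) / 2 : ℕ) : ℕ∞) ≤ E.ncdist C :=
    le_iInf₂ fun n hn => by
      have := hC.length_le_two_mul hn
      exact_mod_cast (by omega : (C.length + 1) / 2 ≤ n)
  have hwidth : E.width ≤ E.ncdist C * 2 := by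
    refine hC.width_le.trans (le_trans ?_ (mul_le_mul_left hdist 2))
    exact_mod_cast (by omega : C.length ≤ (C.length + 1) / 2 * 2)
  refine ENNReal.div_le_of_le_mul ?_
  exact_mod_cast ENat.toENNReal_le.mpr hwidth
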